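/- Let $X \subset \mathbb{C}^3$, in coordinates $(z,w,\xi)$, be the real hypersurface $$X = \{ (z,w,\xi) \in \mathbb{C}^3 : z\bar z - (\xi+\bar\xi)\, w\bar w = 0 \}$$ (a real-analytic subvariety of $\mathbb{C}^3$ of real dimension $5$). For $p \in \mathbb{C}^3$ let $\mathcal{X}_p$ be the smallest germ at $(p,\bar p)$ of a complex-analytic subvariety of $\mathbb{C}^3\times\mathbb{C}^3$ that contains the image of the germ $(X,p)$ under $x \mapsto (x,\bar x)$, and let the germ at $p$ of the Segre variety of $X$ be $$\Sigma_p X = \bigl(\{ x : (x,\bar p) \in \mathcal{X}_p \},\, p\bigr).$$ Let $X_{[3]} = \{ p \in \mathbb{C}^3 : \dim_{\mathbb{C}} \Sigma_p X \geq 3 \}$ be the set of Segre-degenerate points of $X$. (Here the empty germ has dimension $-\infty$.) Then $$X_{[3]} = \{ (z,w,\xi) \in \mathbb{C}^3 : z = w = 0,\ \operatorname{Re}\xi \geq 0 \}.$$ This set is a semianalytic subset of $\mathbb{C}^3$, but it is not a real-analytic subvariety of $\mathbb{C}^3$. -/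

import Mathlib

open Set Filter Topology

namespace Segre

section General

variable (𝕜 : Type*) [NontriviallyNormedField 𝕜]
  {E : Type*} [NormedAddCommGroup E] [NormedSpace 𝕜 E]

/-- `X` is an analytic subvariety of the open set `U`: a subset of `U` which, near every point
of `U`, is the common zero set of a family of analytic functions. For `𝕜 = ℝ` this is a
real-analytic subvariety, for `𝕜 = ℂ` a complex-analytic subvariety. -/
def IsAnalyticSubvariety (U X : Set E) : Prop :=
  X ⊆ U ∧ ∀ p ∈ U, ∃ V : Set E, IsOpen V ∧ p ∈ V ∧ V ⊆ U ∧
    ∃ F : Set (E → 𝕜), (∀ f ∈ F, AnalyticOnNhd 𝕜 f V) ∧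
      X ∩ V = {q | q ∈ V ∧ ∀ f ∈ F, f q = 0}

/-- `p` is a regular point of `S` of dimension `d`: near `p`, the set `S` is an analytic
submanifold of dimension `d`, given as the zero set of an analytic submersion onto `𝕜 ^ c`,
where `c` is the codimension. -/
def IsRegularPoint (S : Set E) (p : E) (d : ℕ) : Prop :=
  p ∈ S ∧ ∃ c : ℕ, d + c = Module.finrank 𝕜 E ∧
    ∃ V : Set E, IsOpen V ∧ p ∈ V ∧ ∃ F : E → (Fin c → 𝕜),
      AnalyticOnNhd 𝕜 F V ∧ Function.Surjective (fderiv 𝕜 F p) ∧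
        S ∩ V = {q | q ∈ V ∧ F q = 0}

/-- The dimension of `S`: the maximal dimension at a regular point (`⊥` if there is none,
in particular for the empty set). -/
noncomputable def analyticDim (S : Set E) : WithBot ℕ∞ :=
  ⨆ (p : E) (d : ℕ) (_ : IsRegularPoint 𝕜 S p d), ((d : ℕ∞) : WithBot ℕ∞)

/-- The dimension of `S` at `p`, or of the germ of `S` at `p`: the minimal dimension
of `S ∩ V` over all open neighbourhoods `V` of `p`. -/
noncomputable def analyticDimAt (S : Set E) (p : E) : WithBot ℕ∞ :=
  ⨅ (V : Set E) (_ : IsOpen V ∧ p ∈ V), analyticDim 𝕜 (S ∩ V)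

/-- `Y` represents the germ at `q` of an analytic subvariety. -/
def IsAnalyticGermAt (Y : Set E) (q : E) : Prop :=
  ∃ W : Set E, IsOpen W ∧ q ∈ W ∧ IsAnalyticSubvariety 𝕜 W (Y ∩ W)

end General

section Semianalytic

variable {E : Type*} [NormedAddCommGroup E] [NormedSpace ℝ E]

/-- The smallest family of subsets of `V` that contains all sets `{x ∈ V | f x ≥ 0}` with `f`
real-analytic on `V` and is closed under finite unions, finite intersections and complements
(in `V`). -/
inductive SemianalyticClass (V : Set E) : Set E → Prop
  | nonneg (f : E → ℝ) (hf : AnalyticOnNhd ℝ f V) : SemianalyticClass V {x | x ∈ V ∧ 0 ≤ f x}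
  | union (A B : Set E) (hA : SemianalyticClass V A) (hB : SemianalyticClass V B) :
      SemianalyticClass V (A ∪ B)
  | inter (A B : Set E) (hA : SemianalyticClass V A) (hB : SemianalyticClass V B) :
      SemianalyticClass V (A ∩ B)
  | compl (A : Set E) (hA : SemianalyticClass V A) : SemianalyticClass V (V \ A)

/-- `X` is a semianalytic subset of the open set `U`. -/
def IsSemianalytic (U X : Set E) : Prop :=
  X ⊆ U ∧ ∀ p ∈ U, ∃ V : Set E, IsOpen V ∧ p ∈ V ∧ V ⊆ U ∧ SemianalyticClass V (X ∩ V)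

end Semianalytic

section SegreVariety

variable {n : ℕ}

/-- The embedding `ι(z) = (z, z̄)` of `ℂⁿ` into `ℂⁿ × ℂⁿ`. -/
def diag (z : Fin n → ℂ) : (Fin n → ℂ) × (Fin n → ℂ) := (z, star z)

/-- `Y` represents the complexification of the germ of `X` at `p`: the smallest germ at
`(p, p̄)` of a complex-analytic subvariety of `ℂⁿ × ℂⁿ` that contains the image of the
germ of `X` at `p` under `ι`. -/
def IsComplexificationAt (X : Set (Fin n → ℂ)) (p : Fin n → ℂ)
    (Y : Set ((Fin n → ℂ) × (Fin n → ℂ))) : Prop :=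
  (IsAnalyticGermAt ℂ Y (diag p) ∧ ∀ᶠ z in 𝓝 p, z ∈ X → diag z ∈ Y) ∧
  ∀ Y' : Set ((Fin n → ℂ) × (Fin n → ℂ)),
    IsAnalyticGermAt ℂ Y' (diag p) → (∀ᶠ z in 𝓝 p, z ∈ X → diag z ∈ Y') →
      ∀ᶠ x in 𝓝 (diag p), x ∈ Y → x ∈ Y'

/-- `S` represents the germ at `p` of the Segre variety of `X`: the germ at `p` of
`{z | (z, p̄) ∈ 𝒳_p}`, where `𝒳_p` is the complexification of the germ of `X` at `p`. -/
def IsSegreVarietyAt (X : Set (Fin n → ℂ)) (p : Fin n → ℂ) (S : Set (Fin n → ℂ)) : Prop :=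
  ∃ Y : Set ((Fin n → ℂ) × (Fin n → ℂ)), IsComplexificationAt X p Y ∧
    ∀ᶠ z in 𝓝 p, (z ∈ S ↔ (z, star p) ∈ Y)

/-- The set `X_[k]` of the points of `U` at which the germ of the Segre variety of `X` has
complex dimension at least `k`; here `X` is a real-analytic subvariety of the open set `U`. -/
def segreLocus (U X : Set (Fin n → ℂ)) (k : ℕ) : Set (Fin n → ℂ) :=
  {p | p ∈ U ∧ ∃ S : Set (Fin n → ℂ), IsSegreVarietyAt X p S ∧
    ((k : ℕ∞) : WithBot ℕ∞) ≤ analyticDimAt ℂ S p}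

end SegreVariety

/-- The set `z z̄ - (ξ + ξ̄) w w̄ = 0` in `ℂ³`, with coordinates
`(z, w, ξ) = (x 0, x 1, x 2)`. -/
def umbrella : Set (Fin 3 → ℂ) :=
  {x | x 0 * star (x 0) - (x 2 + star (x 2)) * (x 1 * star (x 1)) = 0}

end Segre

/-! Let Q = z z' - (ξ + ξ') w w' be the complexified equation. The Segre germ at p lies in the slice
of {Q = 0} at p̄, which has interior points only if z = w = 0 at p. If moreover Re ξ < 0 at p, the
equation forces z = 0 on X near p; then the Segre germ lies in {z = 0} and has dimension below 3.

If z = w = 0 and Re ξ ≥ 0 at p, the point is that {Q = 0} is the whole complexification, so that the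
slice is all of ℂ³. Substituting z = w u, z' = w' u', ξ + ξ' = u u' parametrizes {Q = 0} over w, w'
≠ 0, and the fixed points of a conjugation on the parameters map into X. The condition Re ξ ≥ 0
provides a fixed point over (p, p̄), namely w = w' = 0, u = u' = √(2 Re ξ). The pullback of an
analytic function vanishing on X near p vanishes near that point, because the fixed points are
maximally totally real (`eventually_eq_zero_of_eq_zero_on_fixed`). A point of {Q = 0} near (p, p̄)
may have a huge u = z / w, so the vanishing is carried to it by analytic paths along which w u, w'
u' and u u' stay under control (`exists_path_to_sqrt`). Density of w, w' ≠ 0 finishes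
(`exists_nhds_forall_eq_zero`).

The resulting set is not analytic because a real-analytic function vanishing on a half-line vanishes
on its continuation. -/

namespace Segre

/-! ### Identity theorems -/

section Uniqueness

/-- A function of one complex variable, analytic on a disc about `0`, that vanishes at the real
points of the disc vanishes on the disc. -/
theorem eq_zero_of_eq_zero_on_reals {g : ℂ → ℂ} {r : ℝ} (hr : 0 < r)
    (hg : AnalyticOnNhd ℂ g (Metric.ball 0 r))
    (h0 : ∀ t : ℝ, (t : ℂ) ∈ Metric.ball (0 : ℂ) r → g t = 0) :
    ∀ t ∈ Metric.ball (0 : ℂ) r, g t = 0 := by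
  refine hg.eqOn_zero_of_preconnected_of_frequently_eq_zero
    (convex_ball (0 : ℂ) r).isPreconnected (Metric.mem_ball_self hr) ?_
  have h1 : Tendsto (fun t : ℝ => (t : ℂ)) (𝓝[≠] 0) (𝓝[≠] 0) := by
    refine tendsto_nhdsWithin_iff.2 ⟨?_, ?_⟩
    · exact (Complex.continuous_ofReal.tendsto' 0 0 (by simp)).mono_left nhdsWithin_le_nhds
    · filter_upwards [self_mem_nhdsWithin] with t ht
      simpa using ht
  have h2 : ∀ᶠ t : ℝ in 𝓝[≠] 0, g t = 0 := by
    have : ∀ᶠ t : ℝ in 𝓝 0, (t : ℂ) ∈ Metric.ball (0 : ℂ) r :=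
      (Complex.continuous_ofReal.tendsto' 0 0 (by simp)).eventually (Metric.ball_mem_nhds _ hr)
    filter_upwards [this.filter_mono nhdsWithin_le_nhds] with t ht using h0 t ht
  exact h1.frequently h2.frequently

/-- An analytic function that vanishes, near a fixed point `c` of a conjugation `σ`, at the fixed
points of `σ`, vanishes near `c`: the fixed point set is a maximal totally real subspace. -/
theorem eventually_eq_zero_of_eq_zero_on_fixed {E : Type*} [NormedAddCommGroup E]
    [NormedSpace ℂ E] (σ : E → E) (hadd : ∀ x y, σ (x + y) = σ x + σ y)
    (hsmul : ∀ (a : ℂ) x, σ (a • x) = star a • σ x) (hinv : ∀ x, σ (σ x) = x)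
    (hnorm : ∀ x, ‖σ x‖ ≤ ‖x‖) {G : E → ℂ} {c : E} (hc : σ c = c) (hG : AnalyticAt ℂ G c)
    (h0 : ∀ᶠ x in 𝓝 c, σ x = x → G x = 0) : ∀ᶠ x in 𝓝 c, G x = 0 := by
  obtain ⟨R, hR, hball⟩ := Metric.eventually_nhds_iff_ball.1 (hG.eventually_analyticAt.and h0)
  -- Below, `s` and `t` range over discs of radius 2, which contain 1 and i; since `‖a‖` and `‖b‖`
  -- are at most `‖y‖`, the radius R / 4 keeps `c + (s • a + t • b)` in the ball of radius R.
  refine Metric.eventually_nhds_iff_ball.2 ⟨R / 4, by positivity, fun x hx => ?_⟩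
  set y := x - c with hy
  have hyR : ‖y‖ < R / 4 := by simpa [hy, dist_eq_norm] using hx
  -- The real and imaginary parts of `y` with respect to `σ`. Vanishing for real `s`, `t` is
  -- extended one variable at a time, then evaluated at (1, i).
  set a : E := (1 / 2 : ℂ) • (y + σ y) with ha
  set b : E := (-Complex.I / 2) • (y - σ y) with hb
  have hneg : ∀ z, σ (-z) = -σ z := fun z => by simpa using hsmul (-1) z
  have hσa : σ a = a := by
    simp only [ha, hsmul, hadd, hinv]
    rw [add_comm (σ y)]; congr 1; simp
  have hσb : σ b = b := by
    simp only [hb, hsmul, sub_eq_add_neg, hadd, hneg, hinv]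
    rw [← sub_eq_add_neg, ← sub_eq_add_neg, ← neg_sub y, smul_neg, ← neg_smul]
    congr 1; simp; ring
  have hab : y = a + Complex.I • b := by
    rw [ha, hb, smul_smul]
    have : Complex.I * (-Complex.I / 2) = 1 / 2 := by
      linear_combination (-1 / 2 : ℂ) * Complex.I_mul_I
    rw [this]
    module
  have hna : ‖a‖ ≤ ‖y‖ := by
    rw [ha, norm_smul]
    have := norm_add_le y (σ y)
    have := hnorm y
    norm_num; linarith
  have hnb : ‖b‖ ≤ ‖y‖ := by
    rw [hb, norm_smul]
    have := norm_sub_le y (σ y)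
    have := hnorm y
    norm_num; linarith
  clear_value a b
  have hmem : ∀ s ∈ Metric.ball (0 : ℂ) 2, ∀ t ∈ Metric.ball (0 : ℂ) 2,
      c + (s • a + t • b) ∈ Metric.ball c R := by
    intro s hs t ht
    rw [mem_ball_zero_iff] at hs ht
    rw [mem_ball_iff_norm, add_sub_cancel_left]
    have h1 := norm_add_le (s • a) (t • b)
    have h4 := norm_smul s a
    have h5 := norm_smul t b
    have h2 : ‖s‖ * ‖a‖ ≤ 2 * ‖y‖ := mul_le_mul hs.le hna (norm_nonneg _) (by norm_num)
    have h3 : ‖t‖ * ‖b‖ ≤ 2 * ‖y‖ := mul_le_mul ht.le hnb (norm_nonneg _) (by norm_num)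
    linarith
  have hreal : ∀ t : ℝ, (t : ℂ) ∈ Metric.ball (0 : ℂ) 2 → ∀ s ∈ Metric.ball (0 : ℂ) 2,
      G (c + (s • a + (t : ℂ) • b)) = 0 := by
    intro t ht
    refine eq_zero_of_eq_zero_on_reals two_pos (fun s hs => ?_) (fun s hs => ?_)
    · exact AnalyticAt.fun_comp (hball _ (hmem s hs t ht)).1 (by fun_prop)
    · refine (hball _ (hmem s hs t ht)).2 ?_
      rw [hadd, hadd, hsmul, hsmul, hc, hσa, hσb]
      simp only [Complex.star_def, Complex.conj_ofReal]
  have hcomplex : ∀ s ∈ Metric.ball (0 : ℂ) 2, ∀ t ∈ Metric.ball (0 : ℂ) 2,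
      G (c + (s • a + t • b)) = 0 := by
    intro s hs
    refine eq_zero_of_eq_zero_on_reals two_pos (fun t ht => ?_) (fun t ht => hreal t ht s hs)
    exact AnalyticAt.fun_comp (hball _ (hmem s hs t ht)).1 (by fun_prop)
  have h := hcomplex 1 (by simp) Complex.I (by simp)
  rwa [one_smul, ← hab, hy, add_sub_cancel] at h

/-- An analytic function that vanishes near the beginning of an analytic path vanishes
at its end. -/
theorem eq_zero_of_analytic_path {E : Type*} [NormedAddCommGroup E] [NormedSpace ℂ E]
    {G : E → ℂ} {γ : ℝ → E} (hγ : ∀ t ∈ Icc (0 : ℝ) 1, AnalyticAt ℝ γ t)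
    (hG : ∀ t ∈ Icc (0 : ℝ) 1, AnalyticAt ℂ G (γ t)) (h0 : ∀ᶠ x in 𝓝 (γ 0), G x = 0) :
    G (γ 1) = 0 := by
  have h : AnalyticOnNhd ℝ (fun t => G (γ t)) (Icc 0 1) := fun t ht =>
    (hG t ht).restrictScalars.fun_comp (hγ t ht)
  exact h.eqOn_zero_of_preconnected_of_eventuallyEq_zero isPreconnected_Icc
    (left_mem_Icc.2 zero_le_one)
    ((hγ 0 (left_mem_Icc.2 zero_le_one)).continuousAt.eventually h0)
    (right_mem_Icc.2 zero_le_one)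

end Uniqueness

/-! ### Controlled paths between factorizations -/

/-- Two complex numbers whose product is near `s ≥ 0` are joined to `(√s, √s)` by an analytic
path along which both factors stay bounded and the product does not leave `s` any further. -/
theorem exists_path_to_sqrt {s : ℝ} (hs : 0 ≤ s) :
    ∃ δ > 0, ∀ u v : ℂ, ‖u * v - s‖ < δ → ∃ α β : ℝ → ℂ,
      (∀ t, AnalyticAt ℝ α t) ∧ (∀ t ∈ Icc (0 : ℝ) 1, AnalyticAt ℝ β t) ∧
      α 0 = √s ∧ β 0 = √s ∧ α 1 = u ∧ β 1 = v ∧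
      ∀ t ∈ Icc (0 : ℝ) 1, ‖α t‖ ≤ 3 * (√s + ‖u‖) ∧ ‖β t‖ ≤ 3 * (√s + ‖v‖) ∧
        ‖α t * β t - s‖ ≤ ‖u * v - s‖ := by
  have hof : ∀ t : ℝ, AnalyticAt ℝ (fun t : ℝ => (t : ℂ)) t := fun t =>
    Complex.ofRealCLM.analyticAt t
  rcases hs.eq_or_lt with rfl | hs
  · refine ⟨1, one_pos, fun u v _ => ⟨fun t => t * u, fun t => t * v, fun t => ?_, fun t _ => ?_,
      by simp, by simp, by simp, by simp, fun t ht => ?_⟩⟩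
    · exact (hof t).mul analyticAt_const
    · exact (hof t).mul analyticAt_const
    · have h1 : ‖(t : ℂ)‖ ≤ 1 := by simpa [abs_of_nonneg ht.1] using ht.2
      have hm : ∀ x : ℂ, ‖(t : ℂ) * x‖ ≤ ‖x‖ := fun x => by
        rw [norm_mul]; exact mul_le_of_le_one_left (norm_nonneg _) h1
      refine ⟨?_, ?_, ?_⟩
      · have := hm u; have := norm_nonneg u; simp only [Real.sqrt_zero]; linarith
      · have := hm v; have := norm_nonneg v; simp only [Real.sqrt_zero]; linarith
      · simp only [Complex.ofReal_zero, sub_zero]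
        rw [norm_mul (t * u : ℂ), norm_mul u]
        exact mul_le_mul (hm u) (hm v) (norm_nonneg _) (norm_nonneg _)
  -- This radius forces `‖u * v‖` > s / 2, so `u` has a logarithm, and bounds the numerator of `β`
  -- by 3s / 2.
  · refine ⟨s / 2, by positivity, fun u v huv => ?_⟩
    have hq : 0 < √s := Real.sqrt_pos.2 hs
    have hqq : √s * √s = s := Real.mul_self_sqrt hs.le
    have hqC : ((√s : ℝ) : ℂ) ≠ 0 := by exact_mod_cast hq.ne'
    have hp : s / 2 < ‖u * v‖ := by
      have := norm_sub_norm_le (s : ℂ) (u * v)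
      rw [norm_sub_rev, Complex.norm_of_nonneg hs.le] at this
      linarith
    have huv0 : u * v ≠ 0 := fun h => by rw [h, norm_zero] at hp; linarith
    have hu : u ≠ 0 := left_ne_zero_of_mul huv0
    set A := Complex.log (u / √s) with hA
    have heA : Complex.exp A = u / √s := Complex.exp_log (div_ne_zero hu hqC)
    have hα : ∀ t : ℝ, AnalyticAt ℝ (fun t : ℝ => (√s : ℂ) * Complex.exp (t * A)) t := fun t =>
      analyticAt_const.mul
        ((analyticAt_cexp.restrictScalars (𝕜 := ℝ)).fun_comp
          ((hof t).mul analyticAt_const))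
    have hα0 : ∀ t : ℝ, (√s : ℂ) * Complex.exp (t * A) ≠ 0 := fun t =>
      mul_ne_zero hqC (Complex.exp_ne_zero _)
    -- `α` follows a logarithmic spiral from √s to `u`; `β` is chosen so that the product runs along
    -- the segment from `s` to `u * v`.
    refine ⟨fun t => √s * Complex.exp (t * A),
      fun t => (s + t * (u * v - s)) / (√s * Complex.exp (t * A)), hα, fun t _ => ?_,
      by simp, ?_, ?_, ?_, fun t ht => ?_⟩
    · exact (analyticAt_const.add ((hof t).mul analyticAt_const)).div (hα t) (hα0 t)
    · simp only [Complex.ofReal_zero, zero_mul, add_zero, Complex.exp_zero, mul_one]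
      rw [div_eq_iff hqC]; exact_mod_cast hqq.symm
    · simp only [Complex.ofReal_one, one_mul, heA]; field_simp
    · simp only [Complex.ofReal_one, one_mul, heA]; field_simp; ring
    · have hre : Real.exp A.re = ‖u‖ / √s := by
        rw [← Complex.norm_exp, heA, norm_div, Complex.norm_of_nonneg hq.le]
      have hnα : ‖(√s : ℂ) * Complex.exp (t * A)‖ = √s * Real.exp (t * A.re) := by
        rw [norm_mul, Complex.norm_exp, Complex.norm_of_nonneg hq.le]; simp
      have hnum : ‖(t : ℂ) * (u * v - s)‖ ≤ ‖u * v - s‖ := by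
        rw [norm_mul]
        refine mul_le_of_le_one_left (norm_nonneg _) ?_
        simpa [abs_of_nonneg ht.1] using ht.2
      have hu' : ‖u‖ = √s * Real.exp A.re := by rw [hre]; field_simp
      have hv' : s / 2 < √s * Real.exp A.re * ‖v‖ := by rw [← hu', ← norm_mul]; exact hp
      have hcv := Real.exp_pos (t * A.re)
      refine ⟨?_, ?_, ?_⟩
      · rw [hnα, hu']
        have : Real.exp (t * A.re) ≤ 1 + Real.exp A.re := by
          rcases le_total 0 A.re with h | h
          · have : Real.exp (t * A.re) ≤ Real.exp A.re :=
              Real.exp_le_exp.2 (mul_le_of_le_one_left h ht.2)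
            linarith
          · have : Real.exp (t * A.re) ≤ 1 :=
              Real.exp_le_one_iff.2 (mul_nonpos_of_nonneg_of_nonpos ht.1 h)
            have := Real.exp_pos A.re
            linarith
        have := mul_le_mul_of_nonneg_left this hq.le
        have := mul_pos hq (Real.exp_pos A.re)
        linarith
      · rw [norm_div, hnα, div_le_iff₀ (mul_pos hq hcv)]
        have h1 : ‖(s : ℂ) + t * (u * v - s)‖ ≤ 3 / 2 * s := by
          have := norm_add_le (s : ℂ) (t * (u * v - s))
          rw [Complex.norm_of_nonneg hs.le] at this
          linarith
        refine h1.trans ?_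
        have hE := Real.exp_pos A.re
        have hv0 := norm_nonneg v
        -- Either `α` never gets smaller than √s in norm, or it never gets smaller than `‖u‖`, and
        -- then s / 2 < `‖u‖ * ‖v‖` applies.
        rcases le_total 0 A.re with h | h
        · have h2 : 1 ≤ Real.exp (t * A.re) := Real.one_le_exp (mul_nonneg ht.1 h)
          have h3 : √s * √s ≤ (√s + ‖v‖) * (√s * Real.exp (t * A.re)) :=
            mul_le_mul (by linarith) (le_mul_of_one_le_right hq.le h2) hq.le (by positivity)
          linarith
        · have h2 : Real.exp A.re ≤ Real.exp (t * A.re) := by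
            refine Real.exp_le_exp.2 ?_
            nlinarith [ht.2]
          have h3 : ‖v‖ * (√s * Real.exp A.re) ≤ (√s + ‖v‖) * (√s * Real.exp (t * A.re)) := by
            refine mul_le_mul (by linarith) (by gcongr) (by positivity) (by positivity)
          nlinarith
      · rw [mul_div_cancel₀ _ (hα0 t), add_sub_cancel_left]
        exact hnum

/-! ### Full dimension and interior points -/

section Dimension

variable {𝕜 : Type*} [NontriviallyNormedField 𝕜]
  {E : Type*} [NormedAddCommGroup E] [NormedSpace 𝕜 E]

theorem IsRegularPoint.le_analyticDim {S : Set E} {p : E} {d : ℕ} (h : IsRegularPoint 𝕜 S p d) :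
    ((d : ℕ∞) : WithBot ℕ∞) ≤ analyticDim 𝕜 S :=
  le_iSup_of_le p (le_iSup_of_le d (le_iSup_of_le h le_rfl))

/-- At a point of maximal dimension, a set contains a neighbourhood. -/
theorem IsRegularPoint.mem_nhds {S : Set E} {p : E} {d : ℕ} (h : IsRegularPoint 𝕜 S p d)
    (hd : Module.finrank 𝕜 E ≤ d) : S ∈ 𝓝 p := by
  obtain ⟨-, c, hc, V, hV, hp, F, -, -, hSV⟩ := h
  obtain rfl : c = 0 := by omega
  refine mem_of_superset (hV.mem_nhds hp) fun q hq => ?_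
  have : q ∈ S ∩ V := by rw [hSV]; exact ⟨hq, Subsingleton.elim _ _⟩
  exact this.1

theorem analyticDim_le_of_interior_eq_empty {S : Set E} {m : ℕ}
    (hm : Module.finrank 𝕜 E = m + 1) (hS : ∀ p, S ∉ 𝓝 p) :
    analyticDim 𝕜 S ≤ ((m : ℕ∞) : WithBot ℕ∞) := by
  refine iSup_le fun p => iSup_le fun d => iSup_le fun h => ?_
  have : d ≤ m := by
    by_contra hd
    exact hS p (h.mem_nhds (by omega))
  exact_mod_cast this

/-- Regular points of full dimension are interior points, so a germ of full dimension has interior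
points in every neighbourhood of `p`. -/
theorem exists_mem_nhds_of_le_analyticDimAt {S : Set E} {p : E} {m : ℕ}
    (hm : Module.finrank 𝕜 E = m + 1)
    (h : (((m + 1 : ℕ) : ℕ∞) : WithBot ℕ∞) ≤ analyticDimAt 𝕜 S p) {V : Set E} (hV : V ∈ 𝓝 p) :
    ∃ x, S ∩ V ∈ 𝓝 x := by
  by_contra! hne
  have h1 : analyticDim 𝕜 (S ∩ interior V) ≤ ((m : ℕ∞) : WithBot ℕ∞) :=
    analyticDim_le_of_interior_eq_empty hm fun x hx =>
      hne x (mem_of_superset hx (inter_subset_inter_right _ interior_subset))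
  have h2 : analyticDimAt 𝕜 S p ≤ analyticDim 𝕜 (S ∩ interior V) :=
    iInf_le_of_le (interior V)
      (iInf_le_of_le ⟨isOpen_interior, mem_interior_iff_mem_nhds.2 hV⟩ le_rfl)
  have h3 := (h.trans h2).trans h1
  have : m + 1 ≤ m := by exact_mod_cast h3
  omega

theorem finrank_le_analyticDimAt_univ (p : E) :
    ((Module.finrank 𝕜 E : ℕ∞) : WithBot ℕ∞) ≤ analyticDimAt 𝕜 (univ : Set E) p := by
  refine le_iInf fun V => le_iInf fun hV => IsRegularPoint.le_analyticDim (p := p)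
    ⟨⟨mem_univ p, hV.2⟩, 0, rfl, V, hV.1, hV.2, fun _ => 0, analyticOnNhd_const,
      fun y => ⟨0, Subsingleton.elim _ _⟩, ?_⟩
  ext q; simp

/-- The common zero set of a family of functions analytic on `U` is a subvariety of `U`. -/
theorem isAnalyticSubvariety_zeroSet {U : Set E} (hU : IsOpen U) {ι : Type*} (f : ι → E → 𝕜)
    (hf : ∀ i, AnalyticOnNhd 𝕜 (f i) U) :
    IsAnalyticSubvariety 𝕜 U {q | q ∈ U ∧ ∀ i, f i q = 0} :=
  ⟨fun _ hq => hq.1, fun p hp => ⟨U, hU, hp, subset_rfl, range f,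
    by rintro _ ⟨i, rfl⟩; exact hf i, by ext q; simp +contextual [and_comm]⟩⟩

end Dimension

/-! ### The umbrella as a real hypersurface -/

theorem analyticAt_re_apply {n : ℕ} (i : Fin n) (x : Fin n → ℂ) :
    AnalyticAt ℝ (fun x : Fin n → ℂ => (x i).re) x :=
  (Complex.reCLM.comp (ContinuousLinearMap.proj (R := ℝ) (φ := fun _ : Fin n => ℂ) i)).analyticAt x

theorem analyticAt_im_apply {n : ℕ} (i : Fin n) (x : Fin n → ℂ) :
    AnalyticAt ℝ (fun x : Fin n → ℂ => (x i).im) x :=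
  (Complex.imCLM.comp (ContinuousLinearMap.proj (R := ℝ) (φ := fun _ : Fin n => ℂ) i)).analyticAt x

/-- The real polynomial `|z|² - 2 (Re ξ) |w|²`. -/
def umbrellaFun (x : Fin 3 → ℂ) : ℝ :=
  ((x 0).re * (x 0).re + (x 0).im * (x 0).im) -
    2 * (x 2).re * ((x 1).re * (x 1).re + (x 1).im * (x 1).im)

theorem mem_umbrella_iff {x : Fin 3 → ℂ} : x ∈ umbrella ↔ umbrellaFun x = 0 := by
  have h : x 0 * star (x 0) - (x 2 + star (x 2)) * (x 1 * star (x 1)) = (umbrellaFun x : ℂ) := by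
    apply Complex.ext <;> simp [umbrellaFun] <;> first | ring1 | (left; ring1)
  rw [umbrella, mem_ofPred_eq, h, Complex.ofReal_eq_zero]

theorem analyticOnNhd_umbrellaFun : AnalyticOnNhd ℝ umbrellaFun univ := by
  intro x _
  have h := fun i : Fin 3 => analyticAt_re_apply i x
  have h' := fun i : Fin 3 => analyticAt_im_apply i x
  unfold umbrellaFun
  exact (((h 0).mul (h 0)).add ((h' 0).mul (h' 0))).sub
    ((analyticAt_const.mul (h 2)).mul (((h 1).mul (h 1)).add ((h' 1).mul (h' 1))))

theorem isAnalyticSubvariety_umbrella : IsAnalyticSubvariety ℝ univ umbrella := by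
  convert isAnalyticSubvariety_zeroSet (𝕜 := ℝ) isOpen_univ (fun _ : Unit => umbrellaFun)
    (fun _ => analyticOnNhd_umbrellaFun) using 1
  ext q; simp [mem_umbrella_iff]

/-- Neighbourhoods contain all small translates along a line. -/
theorem eventually_add_smul_mem {𝕜 : Type*} [NontriviallyNormedField 𝕜] [NormedAlgebra 𝕜 ℂ] {n : ℕ}
    {S : Set (Fin n → ℂ)} {x : Fin n → ℂ} (hS : S ∈ 𝓝 x) (v : Fin n → ℂ) :
    ∀ᶠ t : 𝕜 in 𝓝 0, x + t • v ∈ S := by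
  have : Continuous fun t : 𝕜 => x + t • v := by fun_prop
  exact (this.tendsto' 0 x (by simp)).eventually hS

/-- On a real line in the z-direction `umbrellaFun` is a monic quadratic, so it cannot vanish at the
three parameters 0 and ±ε/2. -/
theorem umbrella_notMem_nhds (x : Fin 3 → ℂ) : umbrella ∉ 𝓝 x := by
  intro h
  obtain ⟨ε, hε, hball⟩ := Metric.eventually_nhds_iff_ball.1
    (eventually_add_smul_mem (𝕜 := ℝ) h ![1, 0, 0])
  have h0 := hball 0 (by simpa using hε)
  have h1 := hball (ε / 2) (by simp [abs_of_pos hε]; linarith)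
  have h2 := hball (-(ε / 2)) (by simp [abs_of_pos hε]; linarith)
  rw [mem_umbrella_iff] at h0 h1 h2
  simp [umbrellaFun] at h0 h1 h2
  nlinarith

/-- Empty interior gives the upper bound. At (0, 1, 0) the derivative along Re ξ is -2, so this is a
regular point of codimension 1. -/
theorem analyticDim_umbrella : analyticDim ℝ umbrella = 5 := by
  have hfr : Module.finrank ℝ (Fin 3 → ℂ) = 5 + 1 := by
    rw [Module.finrank_pi_fintype]; simp [Complex.finrank_real_complex]
  refine le_antisymm (analyticDim_le_of_interior_eq_empty hfr umbrella_notMem_nhds) ?_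
  obtain ⟨F, hFdef⟩ : ∃ F : (Fin 3 → ℂ) → Fin 1 → ℝ, F = fun x _ => umbrellaFun x := ⟨_, rfl⟩
  have hF : AnalyticOnNhd ℝ F univ := by
    rw [hFdef]
    exact fun x hx => AnalyticAt.pi fun _ => analyticOnNhd_umbrellaFun x hx
  refine IsRegularPoint.le_analyticDim (p := ![0, 1, 0]) (d := 5)
    ⟨by simp [umbrella], 1, hfr.symm, univ, isOpen_univ, mem_univ _, F, hF, ?_, ?_⟩
  · have hd := (hF ![0, 1, 0] (mem_univ _)).differentiableAt.hasFDerivAt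
    have hl : HasDerivAt (fun t : ℝ => (![0, 1, 0] : Fin 3 → ℂ) + t • ![0, 0, 1]) ![0, 0, 1] 0 := by
      simpa using ((hasDerivAt_id (0 : ℝ)).smul_const (![0, 0, 1] : Fin 3 → ℂ)).const_add
        (![0, 1, 0] : Fin 3 → ℂ)
    have hc := HasFDerivAt.comp_hasDerivAt (l := F) (x := (0 : ℝ))
      (f := fun t : ℝ => (![0, 1, 0] : Fin 3 → ℂ) + t • ![0, 0, 1]) (by simpa using hd) hl
    have he : (F ∘ fun t : ℝ => (![0, 1, 0] : Fin 3 → ℂ) + t • ![0, 0, 1]) = fun t _ => -2 * t := by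
      ext t; simp [hFdef, umbrellaFun]
    rw [he] at hc
    have hv : fderiv ℝ F ![0, 1, 0] ![0, 0, 1] = fun _ => -2 := by
      refine hc.unique (hasDerivAt_pi.2 fun _ => ?_)
      simpa using (hasDerivAt_id (0 : ℝ)).const_mul (-2)
    intro y
    refine ⟨(-(y 0) / 2) • ![0, 0, 1], ?_⟩
    rw [map_smul, hv]
    ext i
    fin_cases i
    simp
  · ext q
    simp [mem_umbrella_iff, funext_iff, hFdef]

/-! ### Semianalytic but not analytic -/

/-- The closed half-line bundle that turns out to be the Segre-degenerate locus. -/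
def degenerateLocus : Set (Fin 3 → ℂ) := {x | x 0 = 0 ∧ x 1 = 0 ∧ 0 ≤ (x 2).re}

theorem isSemianalytic_degenerateLocus : IsSemianalytic univ degenerateLocus := by
  refine ⟨subset_univ _, fun p _ => ⟨univ, isOpen_univ, mem_univ _, subset_univ _, ?_⟩⟩
  have h := fun (i : Fin 3) x => analyticAt_re_apply i x
  have h' := fun (i : Fin 3) x => analyticAt_im_apply i x
  -- The equations z = w = 0 amount to the single inequality -(|z|² + |w|²) ≥ 0.
  have h1 := SemianalyticClass.nonneg (V := univ)
    (fun x : Fin 3 → ℂ => -(((x 0).re * (x 0).re + (x 0).im * (x 0).im) +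
      ((x 1).re * (x 1).re + (x 1).im * (x 1).im)))
    fun x _ => ((((h 0 x).mul (h 0 x)).add ((h' 0 x).mul (h' 0 x))).add
      (((h 1 x).mul (h 1 x)).add ((h' 1 x).mul (h' 1 x)))).neg
  have h2 := SemianalyticClass.nonneg (V := univ) (fun x : Fin 3 → ℂ => (x 2).re) fun x _ => h 2 x
  convert h1.inter _ _ h2 using 1
  ext x
  simp only [degenerateLocus, inter_univ, mem_univ, true_and, mem_inter_iff, mem_ofPred_eq]
  constructor
  · rintro ⟨h0, h1, h2⟩
    simp [h0, h1, h2]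
  · rintro ⟨h0, h2⟩
    refine ⟨Complex.ext ?_ ?_, Complex.ext ?_ ?_, h2⟩ <;>
      simp only [Complex.zero_re, Complex.zero_im] <;> nlinarith

/-- Near the origin, defining functions vanish on the positive real ξ-axis, hence by the identity
theorem also at a point of the negative one. -/
theorem not_isAnalyticSubvariety_degenerateLocus :
    ¬ IsAnalyticSubvariety ℝ univ degenerateLocus := by
  rintro ⟨-, h⟩
  obtain ⟨V, hV, h0V, -, F, hF, hXV⟩ := h 0 (mem_univ _)
  obtain ⟨ε, hε, hball⟩ := Metric.eventually_nhds_iff_ball.1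
    (eventually_add_smul_mem (𝕜 := ℝ) (hV.mem_nhds h0V) ![0, 0, 1])
  set γ : ℝ → Fin 3 → ℂ := fun t => 0 + t • ![0, 0, 1] with hγ
  have hγa : ∀ t, AnalyticAt ℝ γ t := fun t => by
    have : AnalyticAt ℝ (fun t : ℝ => t) t := analyticAt_id
    exact analyticAt_const.add (this.smul analyticAt_const)
  have hmem : -(ε / 2) ∈ Metric.ball (0 : ℝ) ε := by simp [abs_of_pos hε]; linarith
  have key : ∀ f ∈ F, f (γ (-(ε / 2))) = 0 := by
    intro f hf
    have ha : AnalyticOnNhd ℝ (fun t => f (γ t)) (Metric.ball 0 ε) := fun t ht =>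
      (hF f hf _ (hball t ht)).fun_comp (f := γ) (hγa t)
    refine ha.eqOn_zero_of_preconnected_of_eventuallyEq_zero (z₀ := ε / 2)
      (convex_ball (0 : ℝ) ε).isPreconnected (by simp [abs_of_pos hε]; linarith) ?_ hmem
    filter_upwards [Metric.isOpen_ball.mem_nhds
      (show ε / 2 ∈ Metric.ball (0 : ℝ) ε by simp [abs_of_pos hε]; linarith),
      lt_mem_nhds (half_pos hε)] with t ht ht0
    have : γ t ∈ degenerateLocus ∩ V :=
      ⟨by simp [degenerateLocus, hγ, ht0.le], hball t ht⟩
    rw [hXV] at this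
    exact this.2 f hf
  have : γ (-(ε / 2)) ∈ degenerateLocus ∩ V := by
    rw [hXV]; exact ⟨hball _ hmem, key⟩
  have := this.1.2.2
  simp [hγ] at this
  linarith

/-! ### The complexified umbrella -/

section Complexification

/-- The polynomial `z z' - (ξ + ξ') w w'`, which complexifies the equation of `umbrella`. -/
def complexUmbrellaFun (x : (Fin 3 → ℂ) × (Fin 3 → ℂ)) : ℂ :=
  x.1 0 * x.2 0 - (x.1 2 + x.2 2) * (x.1 1 * x.2 1)

theorem analyticAt_fst_apply {n : ℕ} (i : Fin n) (x : (Fin n → ℂ) × (Fin n → ℂ)) :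
    AnalyticAt ℂ (fun x : (Fin n → ℂ) × (Fin n → ℂ) => x.1 i) x :=
  ((ContinuousLinearMap.proj (R := ℂ) (φ := fun _ : Fin n => ℂ) i).comp
    (ContinuousLinearMap.fst ℂ (Fin n → ℂ) (Fin n → ℂ))).analyticAt x

theorem analyticAt_snd_apply {n : ℕ} (i : Fin n) (x : (Fin n → ℂ) × (Fin n → ℂ)) :
    AnalyticAt ℂ (fun x : (Fin n → ℂ) × (Fin n → ℂ) => x.2 i) x :=
  ((ContinuousLinearMap.proj (R := ℂ) (φ := fun _ : Fin n => ℂ) i).comp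
    (ContinuousLinearMap.snd ℂ (Fin n → ℂ) (Fin n → ℂ))).analyticAt x

theorem analyticOnNhd_complexUmbrellaFun : AnalyticOnNhd ℂ complexUmbrellaFun univ := by
  intro x _
  have h := fun i : Fin 3 => analyticAt_fst_apply i x
  have h' := fun i : Fin 3 => analyticAt_snd_apply i x
  exact ((h 0).mul (h' 0)).sub (((h 2).add (h' 2)).mul ((h 1).mul (h' 1)))

/-- The zero set of functions analytic everywhere is an analytic germ at every point. -/
theorem isAnalyticGermAt_zeroSet {ι E : Type*} [NormedAddCommGroup E] [NormedSpace ℂ E]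
    (f : ι → E → ℂ) (hf : ∀ i, AnalyticOnNhd ℂ (f i) univ) (q : E) :
    IsAnalyticGermAt ℂ {x | ∀ i, f i x = 0} q := by
  refine ⟨univ, isOpen_univ, mem_univ _, ?_⟩
  convert isAnalyticSubvariety_zeroSet isOpen_univ f hf using 1
  ext x; simp

theorem isAnalyticGermAt_complexUmbrella (q : (Fin 3 → ℂ) × (Fin 3 → ℂ)) :
    IsAnalyticGermAt ℂ {x | complexUmbrellaFun x = 0} q := by
  simpa using isAnalyticGermAt_zeroSet (fun _ : Unit => complexUmbrellaFun)
    (fun _ => analyticOnNhd_complexUmbrellaFun) q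

theorem frequently_nhds_of_curve {α : Type*} [TopologicalSpace α] {P : α → Prop} {c : ℂ → α}
    (hc : Continuous c) (h : ∀ᶠ a in 𝓝[≠] 0, P (c a)) : ∃ᶠ y in 𝓝 (c 0), P y :=
  ((hc.tendsto 0).mono_left nhdsWithin_le_nhds).frequently h.frequently

theorem eventually_add_ne_zero (z : ℂ) : ∀ᶠ a in 𝓝[≠] (0 : ℂ), z + a ≠ 0 := by
  by_cases hz : z = 0
  · filter_upwards [self_mem_nhdsWithin] with a ha
    simpa [hz] using ha
  · have : Continuous fun a : ℂ => z + a := by fun_prop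
    exact ((this.tendsto' 0 z (by simp)).eventually_ne hz).filter_mono nhdsWithin_le_nhds

/-- The points with `w ≠ 0` and `w' ≠ 0` are dense in the complexified umbrella. -/
theorem frequently_ne_zero_of_complexUmbrellaFun_eq_zero {x : (Fin 3 → ℂ) × (Fin 3 → ℂ)}
    (hx : complexUmbrellaFun x = 0) :
    ∃ᶠ y in 𝓝 x, complexUmbrellaFun y = 0 ∧ y.1 1 ≠ 0 ∧ y.2 1 ≠ 0 := by
  by_cases hne : x.1 1 ≠ 0 ∧ x.2 1 ≠ 0
  · exact Frequently.filter_mono (frequently_pure.2 ⟨hx, hne⟩) (pure_le_nhds x)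
  have hw : x.1 1 * x.2 1 = 0 := by
    rw [mul_eq_zero]; tauto
  have hz : x.1 0 * x.2 0 = 0 := by
    rw [complexUmbrellaFun, hw, mul_zero, sub_zero] at hx; exact hx
  have hcont : ∀ f : Fin 6 → ℂ → ℂ, (∀ i, Continuous (f i)) →
      Continuous fun a => ((![f 0 a, f 1 a, f 2 a], ![f 3 a, f 4 a, f 5 a]) :
        (Fin 3 → ℂ) × (Fin 3 → ℂ)) := by
    intro f hf
    refine Continuous.prodMk (continuous_pi fun i => ?_) (continuous_pi fun i => ?_) <;>
      fin_cases i <;> exact hf _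
  obtain ⟨⟨z, hzd⟩, ⟨w, hwd⟩, ⟨z', hzd'⟩, ⟨w', hwd'⟩⟩ :
    (∃ z, z = x.1 0) ∧ (∃ w, w = x.1 1) ∧ (∃ z', z' = x.2 0) ∧ (∃ w', w' = x.2 1) := by simp
  have hx' : x = (![z, w, x.1 2], ![z', w', x.2 2]) := by
    refine Prod.ext (funext fun i => ?_) (funext fun i => ?_) <;> fin_cases i <;> simp [*]
  rw [← hwd, ← hwd', mul_eq_zero] at hw
  rw [← hzd, ← hzd', mul_eq_zero] at hz
  set s := x.1 2 + x.2 2 with hs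
  have hn := fun v : ℂ => eventually_add_ne_zero v
  have hs0 : ∀ᶠ a in 𝓝[≠] (0 : ℂ), a ≠ 0 := self_mem_nhdsWithin
  -- Keep ξ and ξ' fixed. Translate one of z, z' and one of w, w' by `a`, leaving out a vanishing
  -- one of each pair; the omitted two become `a` times products that solve the equation identically
  -- and tend to 0.
  rcases hw with hw | hw <;> rcases hz with hz | hz
  · have := frequently_nhds_of_curve
      (P := fun y => complexUmbrellaFun y = 0 ∧ y.1 1 ≠ 0 ∧ y.2 1 ≠ 0)
      (hcont ![fun a => a * s * (w' + a), fun a => a * (z' + a), fun _ => x.1 2,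
        fun a => z' + a, fun a => w' + a, fun _ => x.2 2]
        (fun i => by fin_cases i <;> simp <;> fun_prop)) (by
        filter_upwards [hn z', hn w', hs0] with a h1 h2 h3
        simp [complexUmbrellaFun, h1, h2, h3]; ring)
    rw [hx']; simpa [hw, hz] using this
  · have := frequently_nhds_of_curve
      (P := fun y => complexUmbrellaFun y = 0 ∧ y.1 1 ≠ 0 ∧ y.2 1 ≠ 0)
      (hcont ![fun a => z + a, fun a => a * (z + a), fun _ => x.1 2,
        fun a => a * s * (w' + a), fun a => w' + a, fun _ => x.2 2]
        (fun i => by fin_cases i <;> simp <;> fun_prop)) (by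
        filter_upwards [hn z, hn w', hs0] with a h1 h2 h3
        simp [complexUmbrellaFun, h1, h2, h3]; ring)
    rw [hx']; simpa [hw, hz] using this
  · have := frequently_nhds_of_curve
      (P := fun y => complexUmbrellaFun y = 0 ∧ y.1 1 ≠ 0 ∧ y.2 1 ≠ 0)
      (hcont ![fun a => a * s * (w + a), fun a => w + a, fun _ => x.1 2,
        fun a => z' + a, fun a => a * (z' + a), fun _ => x.2 2]
        (fun i => by fin_cases i <;> simp <;> fun_prop)) (by
        filter_upwards [hn z', hn w, hs0] with a h1 h2 h3
        simp [complexUmbrellaFun, h1, h2, h3]; ring)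
    rw [hx']; simpa [hw, hz] using this
  · have := frequently_nhds_of_curve
      (P := fun y => complexUmbrellaFun y = 0 ∧ y.1 1 ≠ 0 ∧ y.2 1 ≠ 0)
      (hcont ![fun a => z + a, fun a => w + a, fun _ => x.1 2,
        fun a => a * s * (w + a), fun a => a * (z + a), fun _ => x.2 2]
        (fun i => by fin_cases i <;> simp <;> fun_prop)) (by
        filter_upwards [hn z, hn w, hs0] with a h1 h2 h3
        simp [complexUmbrellaFun, h1, h2, h3]; ring)
    rw [hx']; simpa [hw, hz] using this

/-! ### Parametrization and propagation of zeros -/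

/-- The map `(w, w', u, u', τ) ↦ (z, w, ξ, z', w', ξ')` with `z = w u`, `z' = w' u'`,
`ξ + ξ' = u u'`, `ξ - ξ' = τ`, which parametrizes the complexified umbrella. -/
noncomputable def umbrellaParam (y : ℂ × ℂ × ℂ × ℂ × ℂ) : (Fin 3 → ℂ) × (Fin 3 → ℂ) :=
  (![y.1 * y.2.2.1, y.1, (y.2.2.1 * y.2.2.2.1 + y.2.2.2.2) / 2],
    ![y.2.1 * y.2.2.2.1, y.2.1, (y.2.2.1 * y.2.2.2.1 - y.2.2.2.2) / 2])

theorem analyticAt_umbrellaParam (y : ℂ × ℂ × ℂ × ℂ × ℂ) : AnalyticAt ℂ umbrellaParam y := by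
  unfold umbrellaParam
  have h1 : AnalyticAt ℂ (fun y : ℂ × ℂ × ℂ × ℂ × ℂ => y.1) y := analyticAt_fst
  have h2 : AnalyticAt ℂ (fun y : ℂ × ℂ × ℂ × ℂ × ℂ => y.2.1) y :=
    analyticAt_fst.fun_comp analyticAt_snd
  have s2 : AnalyticAt ℂ (fun y : ℂ × ℂ × ℂ × ℂ × ℂ => y.2.2) y :=
    analyticAt_snd.fun_comp analyticAt_snd
  have h3 : AnalyticAt ℂ (fun y : ℂ × ℂ × ℂ × ℂ × ℂ => y.2.2.1) y := analyticAt_fst.fun_comp s2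
  have s3 : AnalyticAt ℂ (fun y : ℂ × ℂ × ℂ × ℂ × ℂ => y.2.2.2) y := analyticAt_snd.fun_comp s2
  have h4 : AnalyticAt ℂ (fun y : ℂ × ℂ × ℂ × ℂ × ℂ => y.2.2.2.1) y := analyticAt_fst.fun_comp s3
  have h5 : AnalyticAt ℂ (fun y : ℂ × ℂ × ℂ × ℂ × ℂ => y.2.2.2.2) y := analyticAt_snd.fun_comp s3
  refine AnalyticAt.prod (AnalyticAt.pi fun i => ?_) (AnalyticAt.pi fun i => ?_) <;>
    fin_cases i
  · exact h1.mul h3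
  · exact h1
  · exact ((h3.mul h4).add h5).div_const
  · exact h2.mul h4
  · exact h2
  · exact ((h3.mul h4).sub h5).div_const

/-- The conjugation of the parameter space whose fixed points parametrize the umbrella. -/
def paramConj (y : ℂ × ℂ × ℂ × ℂ × ℂ) : ℂ × ℂ × ℂ × ℂ × ℂ :=
  (star y.2.1, star y.1, star y.2.2.2.1, star y.2.2.1, -star y.2.2.2.2)

theorem norm_paramConj_le (y : ℂ × ℂ × ℂ × ℂ × ℂ) : ‖paramConj y‖ ≤ ‖y‖ := by
  simp only [paramConj, Prod.norm_def, norm_star, norm_neg]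
  refine max_le ?_ (max_le ?_ (max_le ?_ (max_le ?_ ?_))) <;> simp

/-- At a fixed point w' = w̄, u' = ū and τ is imaginary, so ξ' = ξ̄ and the equation becomes |w u|²
= |u|² |w|². -/
theorem exists_umbrellaParam_eq_diag {y : ℂ × ℂ × ℂ × ℂ × ℂ} (hy : paramConj y = y) :
    (umbrellaParam y).1 ∈ umbrella ∧ umbrellaParam y = diag (umbrellaParam y).1 := by
  obtain ⟨w, w', u, u', τ⟩ := y
  simp only [paramConj, Prod.mk.injEq] at hy
  obtain ⟨-, rfl, -, rfl, hτ⟩ := hy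
  have hτ' : star τ = -τ := by rw [← neg_eq_iff_eq_neg, hτ]
  constructor
  · simp only [umbrella, umbrellaParam, mem_ofPred_eq]
    simp at hτ' ⊢
    rw [hτ']
    ring
  · refine Prod.ext rfl (funext fun i => ?_)
    fin_cases i <;> simp [umbrellaParam, diag] at hτ' ⊢
    rw [hτ']
    ring

/-- The functions analytic on a fixed neighbourhood of `(p, p̄)` that vanish on the umbrella near
`p` vanish on the complexified umbrella, on a neighbourhood of `(p, p̄)` independent of the
function. -/
theorem exists_nhds_forall_eq_zero {p : Fin 3 → ℂ} (hp : p ∈ degenerateLocus)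
    {V : Set ((Fin 3 → ℂ) × (Fin 3 → ℂ))} (hV : V ∈ 𝓝 (diag p)) :
    ∃ W ∈ 𝓝 (diag p), ∀ f : (Fin 3 → ℂ) × (Fin 3 → ℂ) → ℂ, AnalyticOnNhd ℂ f V →
      (∀ᶠ z in 𝓝 p, z ∈ umbrella → f (diag z) = 0) →
      ∀ x ∈ W, complexUmbrellaFun x = 0 → f x = 0 := by
  obtain ⟨hp0, hp1, hp2⟩ := hp
  obtain ⟨R, hR, hRV⟩ := Metric.mem_nhds_iff.1 hV
  set s : ℝ := 2 * (p 2).re with hs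
  have hs0 : 0 ≤ s := by positivity
  obtain ⟨δ, hδ, hpath⟩ := exists_path_to_sqrt hs0
  have hq0 := Real.sqrt_nonneg s
  have hqq : (√s : ℂ) * √s = p 2 + star (p 2) := by
    rw [← Complex.ofReal_mul, Real.mul_self_sqrt hs0, Complex.star_def, Complex.add_conj]
  have hss : (s : ℂ) = p 2 + star (p 2) := by
    rw [Complex.star_def, Complex.add_conj]
  set τ₀ : ℂ := p 2 - star (p 2) with hτ₀
  set c : ℂ × ℂ × ℂ × ℂ × ℂ := (0, 0, √s, √s, τ₀) with hc
  have hφc : umbrellaParam c = diag p := by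
    refine Prod.ext (funext fun i => ?_) (funext fun i => ?_) <;> fin_cases i <;>
      simp [umbrellaParam, diag, hc, hp0, hp1]
    · rw [hqq, hτ₀]; simp
    · rw [hqq, hτ₀]; simp
  have hσc : paramConj c = c := by
    simp [paramConj, hc, hτ₀]
  -- The first bound keeps z = w u and z' = w' u' within R along the path; the second makes u u'
  -- δ-close to `s`.
  set r := min (R / (3 * (√s + 1))) (δ / 2) with hr
  have hr0 : 0 < r := lt_min (by positivity) (by positivity)
  have hrR : 3 * (√s + 1) * r ≤ R := by
    have : r ≤ R / (3 * (√s + 1)) := min_le_left _ _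
    rwa [le_div_iff₀' (by positivity)] at this
  have hrδ : 2 * r ≤ δ := by
    have : r ≤ δ / 2 := min_le_right _ _
    linarith
  have hr3 : 3 * r ≤ R := by nlinarith
  have hball : ∀ {ρ : ℝ}, 0 < ρ → ∀ x, x ∈ Metric.ball (diag p) ρ ↔
      (‖x.1 0‖ < ρ ∧ ‖x.1 1‖ < ρ ∧ ‖x.1 2 - p 2‖ < ρ) ∧
      (‖x.2 0‖ < ρ ∧ ‖x.2 1‖ < ρ ∧ ‖x.2 2 - star (p 2)‖ < ρ) := by
    intro ρ hρ x
    rw [mem_ball_iff_norm, Prod.norm_def, max_lt_iff, pi_norm_lt_iff hρ, pi_norm_lt_iff hρ]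
    simp [Fin.forall_fin_succ, diag, hp0, hp1]
  refine ⟨Metric.ball (diag p) r, Metric.ball_mem_nhds _ hr0, fun f hf hfX => ?_⟩
  have hlocal : ∀ᶠ y in 𝓝 c, f (umbrellaParam y) = 0 := by
    refine eventually_eq_zero_of_eq_zero_on_fixed paramConj ?_ ?_ ?_ norm_paramConj_le hσc
      (G := fun y => f (umbrellaParam y)) ?_ ?_
    · intro x y; simp [paramConj]; ring
    · intro a x; simp [paramConj]
    · intro x; simp [paramConj]
    · exact (hf _ (by rw [hφc]; exact mem_of_mem_nhds hV)).fun_comp (analyticAt_umbrellaParam c)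
    · have h1 : Tendsto (fun y => (umbrellaParam y).1) (𝓝 c) (𝓝 p) := by
        have := continuousAt_fst.tendsto.comp (analyticAt_umbrellaParam c).continuousAt.tendsto
        rwa [hφc] at this
      filter_upwards [h1.eventually hfX] with y hy hfix
      obtain ⟨h2, h3⟩ := exists_umbrellaParam_eq_diag hfix
      rw [h3]; exact hy h2
  have hgen : ∀ x ∈ Metric.ball (diag p) r, complexUmbrellaFun x = 0 → x.1 1 ≠ 0 → x.2 1 ≠ 0 →
      f x = 0 := by
    intro x hx hx0 hw hw'
    obtain ⟨⟨hx1, hx2, hx3⟩, hx4, hx5, hx6⟩ := (hball hr0 x).1 hx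
    have huv : x.1 0 / x.1 1 * (x.2 0 / x.2 1) = x.1 2 + x.2 2 := by
      rw [complexUmbrellaFun, sub_eq_zero] at hx0
      field_simp
      linear_combination hx0
    have hsum : ‖x.1 0 / x.1 1 * (x.2 0 / x.2 1) - s‖ < 2 * r := by
      rw [huv, hss, add_sub_add_comm]
      have := norm_add_le (x.1 2 - p 2) (x.2 2 - star (p 2))
      linarith
    have hdiff : ‖x.1 2 - x.2 2 - τ₀‖ < 2 * r := by
      rw [hτ₀, sub_sub_sub_comm]
      have := norm_sub_le (x.1 2 - p 2) (x.2 2 - star (p 2))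
      linarith
    obtain ⟨α, β, hα, hβ, hα0, hβ0, hα1, hβ1, hb⟩ := hpath _ _ (hsum.trans_le hrδ)
    -- Scaling w by `t` starts the path at `c`, and the bound on `α` linear in `‖z / w‖` becomes,
    -- after multiplication by w, one in `‖w‖` and `‖z‖` only.
    set γ : ℝ → ℂ × ℂ × ℂ × ℂ × ℂ := fun t =>
      (t * x.1 1, t * x.2 1, α t, β t, τ₀ + t * (x.1 2 - x.2 2 - τ₀)) with hγ
    have hγ0 : γ 0 = c := by simp [hγ, hc, hα0, hβ0]
    have hγ1 : umbrellaParam (γ 1) = x := by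
      refine Prod.ext (funext fun i => ?_) (funext fun i => ?_) <;> fin_cases i <;>
        simp [umbrellaParam, hγ, hα1, hβ1]
      · field_simp
      · rw [huv]; ring
      · field_simp
      · rw [huv]; ring
    have hγa : ∀ t ∈ Icc (0 : ℝ) 1, AnalyticAt ℝ γ t := by
      intro t ht
      have hof : AnalyticAt ℝ (fun t : ℝ => (t : ℂ)) t := Complex.ofRealCLM.analyticAt t
      exact (hof.mul analyticAt_const).prod ((hof.mul analyticAt_const).prod
        ((hα t).prod ((hβ t ht).prod (analyticAt_const.add (hof.mul analyticAt_const)))))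
    have hγV : ∀ t ∈ Icc (0 : ℝ) 1, umbrellaParam (γ t) ∈ V := by
      intro t ht
      obtain ⟨hb1, hb2, hb3⟩ := hb t ht
      have hm : ∀ x : ℂ, ‖(t : ℂ) * x‖ ≤ ‖x‖ := fun x => by
        rw [norm_mul]
        refine mul_le_of_le_one_left (norm_nonneg _) ?_
        simpa [abs_of_nonneg ht.1] using ht.2
      have hprod : ∀ w z a : ℂ, w ≠ 0 → ‖w‖ < r → ‖z‖ < r → ‖a‖ ≤ 3 * (√s + ‖z / w‖) →
          ‖(t : ℂ) * w * a‖ < R := by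
        intro w z a hw0 hw hz ha
        have h1 : ‖w‖ * ‖z / w‖ = ‖z‖ := by rw [← norm_mul, mul_div_cancel₀ _ hw0]
        have h2 : ‖(t : ℂ) * w * a‖ ≤ ‖w‖ * (3 * (√s + ‖z / w‖)) := by
          rw [norm_mul]
          exact mul_le_mul (hm w) ha (norm_nonneg _) (norm_nonneg _)
        have h3 := mul_le_mul_of_nonneg_left hw.le hq0
        nlinarith
      have ht2 := hm (x.1 2 - x.2 2 - τ₀)
      refine hRV ((hball hR _).2 ⟨⟨?_, ?_, ?_⟩, ?_, ?_, ?_⟩)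
      · exact hprod _ _ _ hw hx2 hx1 hb1
      · exact ((hm _).trans_lt hx2).trans_le (by linarith)
      · have h1 : (umbrellaParam (γ t)).1 2 - p 2 =
            ((α t * β t - s) + t * (x.1 2 - x.2 2 - τ₀)) / 2 := by
          simp only [umbrellaParam, hγ, hss, hτ₀]; simp; ring
        rw [h1, norm_div]
        have := norm_add_le (α t * β t - s) (t * (x.1 2 - x.2 2 - τ₀))
        norm_num
        linarith
      · exact hprod _ _ _ hw' hx5 hx4 hb2
      · exact ((hm _).trans_lt hx5).trans_le (by linarith)
      · have h1 : (umbrellaParam (γ t)).2 2 - star (p 2) =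
            ((α t * β t - s) - t * (x.1 2 - x.2 2 - τ₀)) / 2 := by
          simp only [umbrellaParam, hγ, hss, hτ₀]; simp; ring
        rw [h1, norm_div]
        have := norm_sub_le (α t * β t - s) (t * (x.1 2 - x.2 2 - τ₀))
        norm_num
        linarith
    rw [← hγ1]
    refine eq_zero_of_analytic_path (G := fun y => f (umbrellaParam y)) hγa (fun t ht => ?_) ?_
    · exact (hf _ (hγV t ht)).fun_comp (analyticAt_umbrellaParam _)
    · rw [hγ0]; exact hlocal
  intro x hx hx0
  by_contra hfx
  have hxV : x ∈ V := hRV (Metric.ball_subset_ball (by linarith) hx)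
  have h1 : ∀ᶠ y in 𝓝 x, f y ≠ 0 := (hf x hxV).continuousAt.eventually_ne hfx
  obtain ⟨y, ⟨hy0, hy1, hy2⟩, hy3, hy4⟩ :=
    ((frequently_ne_zero_of_complexUmbrellaFun_eq_zero hx0).and_eventually
      (h1.and (Metric.isOpen_ball.mem_nhds hx))).exists
  exact hy3 (hgen y hy4 hy0 hy1 hy2)

/-- The family cutting out a competing germ may be infinite; the neighbourhood of
`exists_nhds_forall_eq_zero` serves all its members at once, so no Noetherian argument is needed. -/
theorem isComplexificationAt_umbrella {p : Fin 3 → ℂ} (hp : p ∈ degenerateLocus) :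
    IsComplexificationAt umbrella p {x | complexUmbrellaFun x = 0} := by
  refine ⟨⟨isAnalyticGermAt_complexUmbrella _, Eventually.of_forall fun z hz => hz⟩, ?_⟩
  rintro Y' ⟨W, hW, hpW, -, hloc⟩ hX
  obtain ⟨V, hV, hpV, hVW, F, hF, hYV⟩ := hloc _ hpW
  obtain ⟨N, hN, hNf⟩ := exists_nhds_forall_eq_zero hp (hV.mem_nhds hpV)
  have hcont : Continuous (diag : (Fin 3 → ℂ) → _) := by unfold diag; fun_prop
  filter_upwards [hN, hV.mem_nhds hpV] with x hxN hxV hx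
  have : x ∈ Y' ∩ W ∩ V := by
    rw [hYV]
    refine ⟨hxV, fun f hf => hNf f (hF f hf) ?_ x hxN hx⟩
    filter_upwards [hX, hcont.continuousAt.eventually (hV.mem_nhds hpV)] with z hz hzV hzX
    have : diag z ∈ Y' ∩ W ∩ V := ⟨⟨hz hzX, hVW hzV⟩, hzV⟩
    rw [hYV] at this
    exact this.2 f hf
  exact this.1.1

/-! ### Computation of the Segre-degenerate locus -/

/-- A representative of a Segre variety is contained, near `p`, in the slice of every analytic
germ that contains `X`. -/
theorem IsSegreVarietyAt.eventually_mem {n : ℕ} {X S : Set (Fin n → ℂ)} {p : Fin n → ℂ}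
    (hS : IsSegreVarietyAt X p S) {Y : Set ((Fin n → ℂ) × (Fin n → ℂ))}
    (hY : IsAnalyticGermAt ℂ Y (diag p)) (hX : ∀ᶠ z in 𝓝 p, z ∈ X → diag z ∈ Y) :
    ∀ᶠ z in 𝓝 p, z ∈ S → (z, star p) ∈ Y := by
  obtain ⟨Y₀, hY₀, hS⟩ := hS
  have hc : Continuous fun z : Fin n → ℂ => (z, star p) := by fun_prop
  filter_upwards [hS, (hc.tendsto' p (diag p) rfl).eventually (hY₀.2 Y hY hX)] with z h1 h2 hz
  exact h2 (h1.1 hz)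

theorem segreLocus_umbrella : segreLocus univ umbrella 3 = degenerateLocus := by
  have hfr : Module.finrank ℂ (Fin 3 → ℂ) = 3 := by simp
  ext p
  constructor
  · rintro ⟨-, S, hS, hdim⟩
    have hslice := hS.eventually_mem (isAnalyticGermAt_complexUmbrella _)
      (Eventually.of_forall fun z hz => hz)
    obtain ⟨x, hx⟩ := exists_mem_nhds_of_le_analyticDimAt (m := 2) hfr hdim hslice
    have hQ : ∀ᶠ y in 𝓝 x, y 0 * star (p 0) - (y 2 + star (p 2)) * (y 1 * star (p 1)) = 0 := by
      filter_upwards [hx] with y hy using hy.2 hy.1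
    have hQx := hQ.self_of_nhds
    have hp0 : p 0 = 0 := by
      obtain ⟨a, h1, h2⟩ := (((eventually_add_smul_mem (𝕜 := ℂ) hQ ![1, 0, 0]).filter_mono
        nhdsWithin_le_nhds).and (self_mem_nhdsWithin (s := {0}ᶜ))).exists
      have ha : a ≠ 0 := h2
      simp [-Matrix.add_cons] at h1 hQx
      have : a * (starRingEnd ℂ) (p 0) = 0 := by linear_combination h1 - hQx
      simpa [ha] using this
    have hp1 : p 1 = 0 := by
      -- Moving w and ξ together makes both y-dependent factors of (ξ + ξ̄ₚ) w w̄ₚ nonzero, which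
      -- leaves w̄ₚ = 0.
      obtain ⟨a, h1, h2, h3⟩ := (((eventually_add_smul_mem (𝕜 := ℂ) hQ ![0, 1, 1]).filter_mono
        nhdsWithin_le_nhds).and ((eventually_add_ne_zero (x 2 + star (p 2))).and
          (eventually_add_ne_zero (x 1)))).exists
      simp [hp0, -Matrix.add_cons] at h1 h2 h3
      have h4 : x 2 + a + (starRingEnd ℂ) (p 2) ≠ 0 := fun h => h2 (by rw [← h]; ring)
      tauto
    refine ⟨hp0, hp1, ?_⟩
    by_contra! hneg
    have hY : IsAnalyticGermAt ℂ {x : (Fin 3 → ℂ) × (Fin 3 → ℂ) | x.1 0 = 0} (diag p) := by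
      simpa using isAnalyticGermAt_zeroSet
        (fun (_ : Unit) (x : (Fin 3 → ℂ) × (Fin 3 → ℂ)) => x.1 0)
        (fun _ x _ => analyticAt_fst_apply 0 x) (diag p)
    have hXY : ∀ᶠ z in 𝓝 p, z ∈ umbrella → diag z ∈ {x : (Fin 3 → ℂ) × (Fin 3 → ℂ) | x.1 0 = 0} := by
      have hcont : Continuous fun z : Fin 3 → ℂ => (z 2).re := by fun_prop
      filter_upwards [(hcont.tendsto p).eventually (gt_mem_nhds hneg)] with z hz hzX
      rw [mem_umbrella_iff, umbrellaFun] at hzX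
      have := mul_nonneg (neg_nonneg.2 hz.le)
        (add_nonneg (mul_self_nonneg (z 1).re) (mul_self_nonneg (z 1).im))
      show z 0 = 0
      refine Complex.ext ?_ ?_ <;> simp only [Complex.zero_re, Complex.zero_im] <;> nlinarith
    obtain ⟨x, hx⟩ := exists_mem_nhds_of_le_analyticDimAt (m := 2) hfr hdim
      (hS.eventually_mem hY hXY)
    have hx0 : ∀ᶠ y in 𝓝 x, y 0 = 0 := by
      filter_upwards [hx] with y hy using hy.2 hy.1
    obtain ⟨a, h1, h2⟩ := (((eventually_add_smul_mem (𝕜 := ℂ) hx0 ![1, 0, 0]).filter_mono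
        nhdsWithin_le_nhds).and (eventually_add_ne_zero (x 0))).exists
    exact h2 (by simpa [-Matrix.add_cons] using h1)
  · intro hp
    -- Since z = w = 0 at `p`, the complexified equation holds identically on the slice, so `univ`
    -- represents the Segre germ.
    refine ⟨mem_univ _, univ, ⟨_, isComplexificationAt_umbrella hp, ?_⟩, ?_⟩
    · obtain ⟨h0, h1, -⟩ := hp
      exact Eventually.of_forall fun z => by simp [complexUmbrellaFun, h0, h1]
    · have := finrank_le_analyticDimAt_univ (𝕜 := ℂ) p
      rwa [hfr] at this

end Complexification

end Segre

theorem mainTheorem9 :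
    (Segre.IsAnalyticSubvariety ℝ Set.univ Segre.umbrella ∧
      Segre.analyticDim ℝ Segre.umbrella = 5) ∧
    Segre.segreLocus Set.univ Segre.umbrella 3 =
      {x : Fin 3 → ℂ | x 0 = 0 ∧ x 1 = 0 ∧ 0 ≤ (x 2).re} ∧
    Segre.IsSemianalytic Set.univ (Segre.segreLocus Set.univ Segre.umbrella 3) ∧
    ¬ Segre.IsAnalyticSubvariety ℝ Set.univ (Segre.segreLocus Set.univ Segre.umbrella 3) := by
  rw [Segre.segreLocus_umbrella]
  exact ⟨⟨Segre.isAnalyticSubvariety_umbrella, Segre.analyticDim_umbrella⟩, rfl,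
    Segre.isSemianalytic_degenerateLocus, Segre.not_isAnalyticSubvariety_degenerateLocus⟩
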